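/- A \emph{normal map} (crossed module) is a homomorphism of groups $n\colon M\to G$ together with an action of $G$ on $M$ by automorphisms such that $n({}^{g}m)=g\,n(m)\,g^{-1}$ and ${}^{n(m)}m'=m\,m'\,m^{-1}$ for all $g\in G$, $m,m'\in M$. The \emph{free normal closure} of a homomorphism $\varphi\colon\Gamma\to G$ is the universal factorization $\Gamma\xrightarrow{c_\varphi}\Gamma^{\varphi}\xrightarrow{\widetilde\varphi}G$ of $\varphi$ with $\widetilde\varphi$ a normal map: for every factorization $\Gamma\xrightarrow{\psi}M\xrightarrow{n}G$ of $\varphi$ with $n$ a normal map there is a unique $G$-equivariant homomorphism $f\colon\Gamma^\varphi\to M$ with $f\circ c_\varphi=\psi$ and $n\circ f=\widetilde\varphi$. The \emph{normal closures tower} of $\varphi$ is the tower $\cdots\to\Gamma_3\to\Gamma_2\to\Gamma_1=G$ with homomorphisms $\varphi_i\colon\Gamma\to\Gamma_i$ given by $\varphi_1=\varphi$, $\Gamma_{i+1}=\Gamma_i^{\varphi_i}$, $\varphi_{i+1}=c_{\varphi_i}$, and with $\widetilde{\varphi_i}\colon\Gamma_{i+1}\to\Gamma_i$ as its maps. Let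 $\Gamma_\infty=\varprojlim\Gamma_i$, and let $\varphi_\infty\colon\Gamma\to\Gamma_\infty$ be the homomorphism induced by the $\varphi_i$. For a group $H$ let $\gamma_1(H)=H$ and $\gamma_{k+1}(H)=[\gamma_k(H),H]$; if this series becomes constant after finitely many steps, $\gamma_\infty(H)$ denotes its terminal member. \textbf{Theorem.} Let $\varphi\colon\Gamma\to G$ be a homomorphism of groups. For every $k\ge 1$ the homomorphism $\Gamma/\gamma_k(\Gamma)\to\Gamma_\infty/\gamma_k(\Gamma_\infty)$ induced by $\varphi_\infty$ is injective. If $\Gamma$ and $G$ are finite, then this homomorphism is an isomorphism for every $k\ge 1$; moreover, the descending central series of $\Gamma$ and of $\Gamma_\infty$ terminate, and $\varphi_\infty$ induces an isomorphism $\Gamma/\gamma_\infty(\Gamma)\cong\Gamma_\infty/\gamma_\infty(\Gamma_\infty)$. -/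

import Mathlib

universe u v w

namespace SubnormalClosure

/-- A normal structure (crossed module structure) on a homomorphism `n : M → G`: an action of `G`
on `M` by automorphisms for which `n` is equivariant and which satisfies the Peiffer identity.
A normal map is a homomorphism together with such a structure. -/
structure NormalStructure {M : Type u} {G : Type v} [Group M] [Group G] (n : M →* G) where
  act : G →* MulAut M
  equivariant : ∀ (g : G) (m : M), n (act g m) = g * n m * g⁻¹
  peiffer : ∀ m m' : M, act (n m) m' = m * m' * m⁻¹

section FreeNormalClosure

variable {Γ : Type u} {G : Type v} [Group Γ] [Group G] (φ : Γ →* G)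

/-- The free product of copies `Γ_g` of `Γ`, one for each `g : G`. -/
abbrev Copies (Γ : Type u) (G : Type v) [Group Γ] : Type (max u v) :=
  Monoid.CoprodI (fun _ : G => Γ)

/-- The inclusion of the copy of `Γ` indexed by `g`. -/
def copy (Γ : Type u) {G : Type v} [Group Γ] (g : G) : Γ →* Copies Γ G :=
  Monoid.CoprodI.of (M := fun _ : G => Γ) (i := g)

/-- The homomorphism to `G` sending the element `x` of the copy `Γ_g` to `g φ(x) g⁻¹`. -/
def copiesMap : Copies Γ G →* G :=
  Monoid.CoprodI.lift fun g => (MulAut.conj g).toMonoidHom.comp φ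

/-- Left translation of the indices: `x` in the copy `Γ_g` goes to `x` in the copy `Γ_{hg}`. -/
def shift (Γ : Type u) {G : Type v} [Group Γ] [Group G] (h : G) : Copies Γ G →* Copies Γ G :=
  Monoid.CoprodI.lift fun g => copy Γ (h * g)

/-- The Peiffer subgroup: the normal subgroup generated by all `x y x⁻¹ (∂x • y)⁻¹`. -/
def peifferSubgroup : Subgroup (Copies Γ G) :=
  Subgroup.normalClosure
    {z | ∃ x y : Copies Γ G, z = x * y * x⁻¹ * (shift Γ (copiesMap φ x) y)⁻¹}

instance : (peifferSubgroup φ).Normal := Subgroup.normalClosure_normal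

/-- The free normal closure of `φ : Γ → G`, i.e. the free crossed module over `G` on `φ`. Its
universal property is `FreeNormalClosure.existsUnique_lift`. -/
def FreeNormalClosure : Type (max u v) := Copies Γ G ⧸ peifferSubgroup φ

instance : Group (FreeNormalClosure φ) :=
  inferInstanceAs (Group (Copies Γ G ⧸ peifferSubgroup φ))

@[simp]
theorem copiesMap_copy (g : G) (x : Γ) : copiesMap φ (copy Γ g x) = g * φ x * g⁻¹ := by
  simp [copiesMap, copy]

@[simp]
theorem shift_copy (h g : G) (x : Γ) : shift Γ h (copy Γ g x) = copy Γ (h * g) x := by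
  simp [shift, copy]

theorem copies_hom_ext {Γ : Type u} {G : Type v} [Group Γ] {H : Type w} [Group H] {f f' : Copies Γ G →* H}
    (h : ∀ g x, f (copy Γ g x) = f' (copy Γ g x)) : f = f' :=
  Monoid.CoprodI.ext_hom _ _ fun g => MonoidHom.ext fun x => h g x

theorem shift_one : shift Γ (1 : G) = MonoidHom.id _ :=
  copies_hom_ext fun g x => by simp

theorem shift_mul (a b : G) : shift Γ (a * b) = (shift Γ a).comp (shift Γ b) :=
  copies_hom_ext fun g x => by simp [mul_assoc]

theorem copiesMap_shift (h : G) (y : Copies Γ G) :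
    copiesMap φ (shift Γ h y) = h * copiesMap φ y * h⁻¹ := by
  have : (copiesMap φ).comp (shift Γ h) = (MulAut.conj h).toMonoidHom.comp (copiesMap φ) :=
    copies_hom_ext fun g x => by simp [mul_assoc]
  exact DFunLike.congr_fun this y

theorem peifferSubgroup_le_ker : peifferSubgroup φ ≤ (copiesMap φ).ker := by
  refine Subgroup.normalClosure_le_normal ?_
  rintro _ ⟨x, y, rfl⟩
  simp [MonoidHom.mem_ker, copiesMap_shift]

theorem peifferSubgroup_le_comap_shift (h : G) :
    peifferSubgroup φ ≤ (peifferSubgroup φ).comap (shift Γ h) := by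
  refine Subgroup.normalClosure_le_normal ?_
  rintro _ ⟨x, y, rfl⟩
  refine Subgroup.subset_normalClosure ⟨shift Γ h x, shift Γ h y, ?_⟩
  have e : shift Γ (copiesMap φ (shift Γ h x)) (shift Γ h y)
      = shift Γ h (shift Γ (copiesMap φ x) y) := by
    rw [copiesMap_shift, ← MonoidHom.comp_apply, ← MonoidHom.comp_apply, ← shift_mul, ← shift_mul]
    simp
  rw [e]
  simp

namespace FreeNormalClosure

/-- The canonical map `c_φ : Γ → Γ^φ`, the inclusion of the copy indexed by `1`. -/
def ofDomain : Γ →* FreeNormalClosure φ :=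
  (QuotientGroup.mk' (peifferSubgroup φ)).comp (copy Γ (1 : G))

/-- The canonical normal map `Γ^φ → G`. -/
def toCodomain : FreeNormalClosure φ →* G :=
  QuotientGroup.lift (peifferSubgroup φ) (copiesMap φ) (peifferSubgroup_le_ker φ)

theorem toCodomain_comp_ofDomain : (toCodomain φ).comp (ofDomain φ) = φ :=
  MonoidHom.ext fun x => by
    change copiesMap φ (copy Γ 1 x) = φ x
    simp

/-- The action of an element of `G` on `Γ^φ`. -/
def actHom (h : G) : FreeNormalClosure φ →* FreeNormalClosure φ :=
  QuotientGroup.map _ _ (shift Γ h) (peifferSubgroup_le_comap_shift φ h)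

theorem actHom_mk (h : G) (x : Copies Γ G) :
    actHom φ h (QuotientGroup.mk' (peifferSubgroup φ) x)
      = QuotientGroup.mk' (peifferSubgroup φ) (shift Γ h x) := rfl

theorem actHom_one : actHom φ 1 = MonoidHom.id _ := by
  ext x
  obtain ⟨x, rfl⟩ := QuotientGroup.mk'_surjective _ x
  rw [actHom_mk, shift_one]; rfl

theorem actHom_mul (a b : G) : actHom φ (a * b) = (actHom φ a).comp (actHom φ b) := by
  ext x
  obtain ⟨x, rfl⟩ := QuotientGroup.mk'_surjective _ x
  rw [actHom_mk, shift_mul]; rfl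

/-- The crossed module structure on `Γ^φ → G`. -/
def normalStructure : NormalStructure (toCodomain φ) where
  act :=
    { toFun := fun g => MonoidHom.toMulEquiv (actHom φ g) (actHom φ g⁻¹)
        (by rw [← actHom_mul, inv_mul_cancel, actHom_one])
        (by rw [← actHom_mul, mul_inv_cancel, actHom_one])
      map_one' := MulEquiv.ext fun x => DFunLike.congr_fun (actHom_one φ) x
      map_mul' := fun a b => MulEquiv.ext fun x => DFunLike.congr_fun (actHom_mul φ a b) x }
  equivariant := fun g m => by
    obtain ⟨x, rfl⟩ := QuotientGroup.mk'_surjective _ m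
    exact copiesMap_shift φ g x
  peiffer := fun m m' => by
    obtain ⟨x, rfl⟩ := QuotientGroup.mk'_surjective _ m
    obtain ⟨y, rfl⟩ := QuotientGroup.mk'_surjective _ m'
    have h : x * y * x⁻¹ * (shift Γ (copiesMap φ x) y)⁻¹ ∈ peifferSubgroup φ :=
      Subgroup.subset_normalClosure ⟨x, y, rfl⟩
    have h2 := (QuotientGroup.eq_one_iff _).2 h
    exact (mul_inv_eq_one.1 h2).symm

/-- `Γ → Γ^φ → G` is the universal factorization of `φ` through a normal map. -/
theorem existsUnique_lift {M : Type w} [Group M] (ψ : Γ →* M) (n : M →* G)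
    (S : NormalStructure n) (hφ : n.comp ψ = φ) :
    ∃! f : FreeNormalClosure φ →* M,
      f.comp (ofDomain φ) = ψ ∧ n.comp f = toCodomain φ ∧
        ∀ g x, f ((normalStructure φ).act g x) = S.act g (f x) := by
  let F : Copies Γ G →* M := Monoid.CoprodI.lift fun g => (S.act g).toMonoidHom.comp ψ
  have F_copy : ∀ g x, F (copy Γ g x) = S.act g (ψ x) := fun g x => by simp [F, copy]
  have nF : ∀ x, n (F x) = copiesMap φ x := fun x =>
    DFunLike.congr_fun (copies_hom_ext (f := n.comp F) (f' := copiesMap φ) fun g x => by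
      simp [F_copy, S.equivariant, ← hφ]) x
  have F_shift : ∀ h x, F (shift Γ h x) = S.act h (F x) := fun h x =>
    DFunLike.congr_fun (copies_hom_ext (f := F.comp (shift Γ h))
      (f' := (S.act h).toMonoidHom.comp F) fun g x => by simp [F_copy]) x
  have hF : peifferSubgroup φ ≤ F.ker := by
    refine Subgroup.normalClosure_le_normal ?_
    rintro _ ⟨x, y, rfl⟩
    simp [MonoidHom.mem_ker, F_shift, ← nF, S.peiffer]
  refine ⟨QuotientGroup.lift _ F hF, ⟨?_, ?_, ?_⟩, ?_⟩
  · ext x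
    exact (F_copy 1 x).trans (by simp)
  · ext x
    obtain ⟨x, rfl⟩ := QuotientGroup.mk'_surjective _ x
    exact nF x
  · intro g x
    obtain ⟨x, rfl⟩ := QuotientGroup.mk'_surjective _ x
    exact F_shift g x
  · rintro f ⟨h1, -, h3⟩
    have key : f.comp (QuotientGroup.mk' (peifferSubgroup φ)) = F := by
      refine copies_hom_ext fun g x => ?_
      have := h3 g (ofDomain φ x)
      rw [← MonoidHom.comp_apply f (ofDomain φ), h1] at this
      rw [F_copy, ← this]
      change f _ = f (QuotientGroup.mk' (peifferSubgroup φ) (shift Γ g (copy Γ 1 x)))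
      rw [shift_copy, mul_one]
      rfl
    ext x
    obtain ⟨x, rfl⟩ := QuotientGroup.mk'_surjective _ x
    exact DFunLike.congr_fun key x

end FreeNormalClosure

end FreeNormalClosure

section Tower

/-- A group equipped with a homomorphism from `Γ`. -/
structure GroupUnder (Γ : Type u) [Group Γ] where
  carrier : Type u
  [group : Group carrier]
  hom : Γ →* carrier

attribute [instance] GroupUnder.group

variable {Γ G : Type u} [Group Γ] [Group G] (φ : Γ →* G)

/-- The normal closures tower of `φ`, indexed from `0`: `tower φ i` is `φ_{i+1} : Γ → Γ_{i+1}`,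
so that `tower φ 0` is `φ : Γ → G`. -/
def tower : ℕ → GroupUnder Γ
  | 0 => ⟨G, φ⟩
  | i + 1 => ⟨FreeNormalClosure (tower i).hom, FreeNormalClosure.ofDomain (tower i).hom⟩

/-- The normal map from each term of the tower to the preceding one. -/
def towerMap (i : ℕ) : (tower φ (i + 1)).carrier →* (tower φ i).carrier :=
  FreeNormalClosure.toCodomain (tower φ i).hom

theorem towerMap_hom (i : ℕ) (x : Γ) :
    towerMap φ i ((tower φ (i + 1)).hom x) = (tower φ i).hom x :=
  DFunLike.congr_fun (FreeNormalClosure.toCodomain_comp_ofDomain (tower φ i).hom) x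

/-- The compatible sequences in the product of the terms of the tower. -/
def towerLimit : Subgroup (∀ i, (tower φ i).carrier) where
  carrier := {x | ∀ i, towerMap φ i (x (i + 1)) = x i}
  mul_mem' := fun {x y} hx hy i => by
    rw [Pi.mul_apply, map_mul, hx i, hy i, Pi.mul_apply]
  one_mem' := fun i => map_one (towerMap φ i)
  inv_mem' := fun {x} hx i => by
    rw [Pi.inv_apply, map_inv, hx i, Pi.inv_apply]

/-- `Γ_∞`, the inverse limit of the normal closures tower of `φ`. -/
abbrev GammaInfty : Type u := towerLimit φ

/-- The natural map `φ_∞ : Γ → Γ_∞`. -/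
def homInfty : Γ →* GammaInfty φ :=
  (MonoidHom.pi fun i => (tower φ i).hom).codRestrict (towerLimit φ)
    fun x i => towerMap_hom φ i x

end Tower

section LowerCentralSeries

/-- `γ_k(H)` with the convention `γ_1(H) = H` (only used for `k ≥ 1`); Mathlib's series
starts at `0`. -/
def gammaSeries (H : Type u) [Group H] (k : ℕ) : Subgroup H :=
  (⊤ : Subgroup H).lowerCentralSeries (k - 1)

/-- The descending central series of `H` terminates at `T`. -/
def GammaTerminatesAt (H : Type u) [Group H] (T : Subgroup H) : Prop :=
  ∃ t, 1 ≤ t ∧ ∀ s, t ≤ s → gammaSeries H s = T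

/-- `γ_∞(H)`: the terminal member of the descending central series, if it terminates
(see `GammaTerminatesAt.eq_gammaResidual`). -/
def gammaResidual (H : Type u) [Group H] : Subgroup H := ⨅ k, gammaSeries H k

theorem GammaTerminatesAt.eq_gammaResidual {H : Type u} [Group H] {T : Subgroup H}
    (h : GammaTerminatesAt H T) : gammaResidual H = T := by
  obtain ⟨t, -, ht⟩ := h
  refine le_antisymm ((iInf_le _ t).trans (ht t le_rfl).le) (le_iInf fun k => ?_)
  rw [← ht (max t k) (le_max_left _ _)]
  exact Subgroup.lowerCentralSeries_antitone _ (Nat.sub_le_sub_right (le_max_right t k) 1)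

instance (H : Type u) [Group H] (k : ℕ) : (gammaSeries H k).Normal := by
  unfold gammaSeries; infer_instance

instance (H : Type u) [Group H] : (gammaResidual H).Normal :=
  Subgroup.normal_iInf_normal fun _ => inferInstance

variable {A : Type u} {B : Type v} [Group A] [Group B] (f : A →* B)

theorem gammaSeries_le_comap (k : ℕ) : gammaSeries A k ≤ (gammaSeries B k).comap f := by
  unfold gammaSeries
  induction k - 1 with
  | zero => simp
  | succ n ih =>
    rw [← Subgroup.map_le_iff_le_comap] at ih ⊢
    rw [Subgroup.lowerCentralSeries_succ, Subgroup.lowerCentralSeries_succ,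
      Subgroup.map_commutator]
    exact Subgroup.commutator_mono ih le_top

theorem gammaResidual_le_comap : gammaResidual A ≤ (gammaResidual B).comap f := by
  unfold gammaResidual
  rw [Subgroup.comap_iInf]
  exact iInf_mono fun k => gammaSeries_le_comap f k

/-- The homomorphism `A/γ_k(A) → B/γ_k(B)` induced by `f : A → B`. -/
def gammaQuotientMap (k : ℕ) : A ⧸ gammaSeries A k →* B ⧸ gammaSeries B k :=
  QuotientGroup.map _ _ f (gammaSeries_le_comap f k)

/-- The homomorphism `A/γ_∞(A) → B/γ_∞(B)` induced by `f : A → B`. -/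
def gammaResidualQuotientMap : A ⧸ gammaResidual A →* B ⧸ gammaResidual B :=
  QuotientGroup.map _ _ f (gammaResidual_le_comap f)

end LowerCentralSeries

end SubnormalClosure

/-!
Injectivity: the quotient maps `Γ/γ_{i+1} → Γ/γ_i` are surjective with central kernel, hence normal
maps, so by induction the universal property factors `Γ → Γ/γ_i` through `φ_i`. An element of `Γ`
outside `γ_i` therefore maps outside `γ_i(Γ_∞)`.

Surjectivity: for finite `Γ` and `G` every `Γ_i` is finite, since it is generated by finitely many
torsion elements and, kernels of normal maps being central, its centre has finite index. Let `H` be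
the image of `Γ` in the compact group `K = Γ_∞`, and let `U_i` be the kernel of `K → Γ_i`, so that
`[U_i, K] ≤ U_{i+1}`. As `Γ_{i+1}` maps into `φ_i(Γ)[Γ_i, Γ_i]`, a Mittag-Leffler argument shows
that `H[K, K]` is dense, and what remains is to prove that it is closed. Put `P = ⋂ γ_i(K) U_i`.
Then `K = HP` by compactness, while `P` centralizes `U_0` because `[γ_i(K), U_0] ≤ U_i` by the three
subgroups lemma. So `Z = P ∩ U_0` is a closed normal abelian subgroup of finite index. Now `[Z, K]`
is a product of finitely many compact groups, one for each automorphism of `Z` induced by `K`, and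
by Schur's theorem it has finite index in `[K, K]`, which is therefore closed.
-/

namespace SubnormalClosure

open scoped Pointwise commutatorElement IsMulCommutative

section Commutators

variable {K : Type*} [Group K]

theorem commutator_le_iff_map_mk'_le_centralizer {A B N : Subgroup K} [N.Normal] :
    ⁅A, B⁆ ≤ N ↔ A.map (QuotientGroup.mk' N) ≤
      Subgroup.centralizer (B.map (QuotientGroup.mk' N) : Set (K ⧸ N)) := by
  rw [← Subgroup.commutator_eq_bot_iff_le_centralizer, ← Subgroup.map_commutator,
    Subgroup.map_eq_bot_iff, QuotientGroup.ker_mk']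

theorem commutator_sup_left_le {A B C N : Subgroup K} [N.Normal] (hA : ⁅A, C⁆ ≤ N)
    (hB : ⁅B, C⁆ ≤ N) : ⁅A ⊔ B, C⁆ ≤ N := by
  rw [commutator_le_iff_map_mk'_le_centralizer] at hA hB ⊢
  rw [Subgroup.map_sup]
  exact sup_le hA hB

theorem commutator_commutator_le_of_rotate {A B C N : Subgroup K} [N.Normal]
    (hBCA : ⁅⁅B, C⁆, A⁆ ≤ N) (hCAB : ⁅⁅C, A⁆, B⁆ ≤ N) : ⁅⁅A, B⁆, C⁆ ≤ N := by
  have le_iff (X : Subgroup K) : X ≤ N ↔ X.map (QuotientGroup.mk' N) = ⊥ := by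
    rw [Subgroup.map_eq_bot_iff, QuotientGroup.ker_mk']
  simp only [le_iff, Subgroup.map_commutator] at hBCA hCAB ⊢
  exact Subgroup.commutator_commutator_eq_bot_of_rotate hBCA hCAB

theorem commutator_lowerCentralSeries_le {U : ℕ → Subgroup K} [∀ i, (U i).Normal]
    (hU : ∀ i, ⁅U i, ⊤⁆ ≤ U (i + 1)) (k j : ℕ) :
    ⁅(⊤ : Subgroup K).lowerCentralSeries k, U j⁆ ≤ U (j + k + 1) := by
  induction k generalizing j with
  | zero => exact (Subgroup.commutator_comm_le _ _).trans (hU j)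
  | succ k ih =>
    rw [Subgroup.lowerCentralSeries_succ]
    refine commutator_commutator_le_of_rotate ?_ ?_
    · calc
        ⁅⁅⊤, U j⁆, (⊤ : Subgroup K).lowerCentralSeries k⁆
          ≤ ⁅U (j + 1), (⊤ : Subgroup K).lowerCentralSeries k⁆ :=
            Subgroup.commutator_mono ((Subgroup.commutator_comm_le _ _).trans (hU j)) le_rfl
        _ ≤ U (j + 1 + k + 1) := (Subgroup.commutator_comm_le _ _).trans (ih (j + 1))
        _ = U (j + (k + 1) + 1) := by rw [add_right_comm j 1 k, add_assoc j k 1]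
    · calc
        ⁅⁅U j, (⊤ : Subgroup K).lowerCentralSeries k⁆, ⊤⁆
          ≤ ⁅U (j + k + 1), ⊤⁆ :=
            Subgroup.commutator_mono ((Subgroup.commutator_comm_le _ _).trans (ih j)) le_rfl
        _ ≤ U (j + (k + 1) + 1) := hU _

theorem commutator_le_sup_commutator_top {H N : Subgroup K} (h : H ⊔ N = ⊤) :
    commutator K ≤ H ⊔ ⁅N, ⊤⁆ := by
  set L := H ⊔ ⁅N, ⊤⁆
  have hNL : ⁅N, ⊤⁆ ≤ L := le_sup_right
  have hnormal : L.Normal := by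
    rw [← Subgroup.normalizer_eq_top_iff, eq_top_iff, ← h]
    refine sup_le (le_sup_left.trans Subgroup.le_normalizer) ?_
    rw [Subgroup.le_normalizer_iff_commutator_le_right]
    exact (Subgroup.commutator_mono le_rfl le_top).trans hNL
  -- Modulo `L` the subgroup `N` becomes central, and it becomes everything.
  have hmap : (⊤ : Subgroup K).map (QuotientGroup.mk' L) = N.map (QuotientGroup.mk' L) := by
    rw [Subgroup.map_eq_map_iff, QuotientGroup.ker_mk', top_sup_eq, eq_comm, eq_top_iff, ← h,
      sup_comm N]
    exact sup_le_sup_right le_sup_left N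
  rw [commutator_def, commutator_le_iff_map_mk'_le_centralizer, hmap,
    ← commutator_le_iff_map_mk'_le_centralizer]
  exact (Subgroup.commutator_mono le_rfl le_top).trans hNL

theorem sup_lowerCentralSeries_eq_top {H : Subgroup K} (h : H ⊔ commutator K = ⊤) (k : ℕ) :
    H ⊔ (⊤ : Subgroup K).lowerCentralSeries k = ⊤ := by
  induction k with
  | zero => rw [Subgroup.lowerCentralSeries_zero, sup_top_eq]
  | succ k ih =>
    refine eq_top_iff.2 (h.ge.trans (sup_le le_sup_left ?_))
    exact commutator_le_sup_commutator_top ih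

theorem finite_commutatorSet_of_finiteIndex_center [(Subgroup.center K).FiniteIndex] :
    Finite (commutatorSet K) := by
  let commutatorOut : (K ⧸ Subgroup.center K) × (K ⧸ Subgroup.center K) → K :=
    fun q => ⁅q.1.out, q.2.out⁆
  refine (Set.finite_range commutatorOut).subset ?_
  rintro _ ⟨a, b, rfl⟩
  obtain ⟨⟨y, hy⟩, ha⟩ := QuotientGroup.mk_out_eq_mul (Subgroup.center K) a
  obtain ⟨⟨z, hz⟩, hb⟩ := QuotientGroup.mk_out_eq_mul (Subgroup.center K) b
  have hy' (g : K) : ⁅y, g⁆ = 1 :=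
    commutatorElement_eq_one_iff_mul_comm.2 (Subgroup.mem_center_iff.1 hy g).symm
  have hz' (g : K) : ⁅g, z⁆ = 1 :=
    commutatorElement_eq_one_iff_mul_comm.2 (Subgroup.mem_center_iff.1 hz g)
  refine ⟨(a, b), ?_⟩
  change ⁅(a : K ⧸ Subgroup.center K).out, (b : K ⧸ Subgroup.center K).out⁆ = _
  rw [ha, hb, commutatorElement_mul_left_eq_conj_mul, hy', mul_one, mul_inv_cancel, one_mul,
    commutatorElement_mul_right_eq_mul_conj, hz', mul_one, mul_inv_cancel_right]

theorem finite_commutator_of_finiteIndex_center [(Subgroup.center K).FiniteIndex] :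
    Finite (commutator K) :=
  have := finite_commutatorSet_of_finiteIndex_center (K := K)
  inferInstance

theorem finite_of_finiteIndex_center_of_closure_eq_top [(Subgroup.center K).FiniteIndex]
    {S : Set K} (hS : S.Finite) (htorsion : ∀ x ∈ S, IsOfFinOrder x)
    (hgen : Subgroup.closure S = ⊤) : Finite K := by
  have hfg : Group.FG K := Group.fg_iff.2 ⟨S, hgen, hS⟩
  have : Group.FG (Abelianization K) :=
    Group.fg_of_surjective (f := Abelianization.of) (QuotientGroup.mk'_surjective _)
  have htop : (CommGroup.torsion (Abelianization K)).comap Abelianization.of = ⊤ := by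
    rw [eq_top_iff, ← hgen, Subgroup.closure_le]
    exact fun x hx => Abelianization.of.isOfFinOrder (htorsion x hx)
  have : Finite (K ⧸ commutator K) :=
    CommGroup.finite_of_fg_isMulTorsion (Abelianization K) fun a => by
      obtain ⟨x, rfl⟩ := QuotientGroup.mk'_surjective _ a
      exact htop.ge (Subgroup.mem_top x)
  have := finite_commutator_of_finiteIndex_center (K := K)
  exact Finite.of_subgroup_quotient (commutator K)

theorem finiteIndex_of_sup_eq_top {H N : Subgroup K} [Finite H] [N.Normal] (h : H ⊔ N = ⊤) :
    N.FiniteIndex := by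
  rw [Subgroup.finiteIndex_iff, ← Subgroup.relIndex_top_right, ← h, Subgroup.relIndex_sup_right]
  exact Subgroup.index_ne_zero_of_finite

end Commutators

theorem exists_forall_ge_eq_iInf_of_antitone {α : Type*} [CompleteLattice α] [WellFoundedLT α]
    {f : ℕ → α} (hf : Antitone f) : ∃ n, ∀ j, n ≤ j → f j = ⨅ i, f i := by
  obtain ⟨n, hn⟩ := WellFoundedLT.antitone_chain_condition hf
  have hinf : f n = ⨅ i, f i := (le_iInf fun i => (hn _ (le_max_left n i)).trans_le
    (hf (le_max_right n i))).antisymm (iInf_le f n)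
  exact ⟨n, fun j hj => (hn j hj).symm.trans hinf⟩

section CompactGroups

variable {K : Type*} [Group K] [TopologicalSpace K] [IsTopologicalGroup K] [CompactSpace K]

theorem mul_iInf_eq_iInter_mul {C : Set K} (hC : IsClosed C) {W : ℕ → Subgroup K}
    (hW : Antitone W) (hWclosed : ∀ i, IsClosed (W i : Set K)) :
    C * ((⨅ i, W i : Subgroup K) : Set K) = ⋂ i, C * (W i : Set K) := by
  refine (Set.subset_iInter fun i => Set.mul_subset_mul_left (iInf_le W i)).antisymm fun x hx => ?_
  have closed_solutions (i : ℕ) : IsClosed {c | c ∈ C ∧ c⁻¹ * x ∈ W i} :=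
    hC.inter ((hWclosed i).preimage (by fun_prop))
  obtain ⟨c, hc⟩ := IsCompact.nonempty_iInter_of_sequence_nonempty_isCompact_isClosed
    (fun i => {c | c ∈ C ∧ c⁻¹ * x ∈ W i}) (fun i c hc => ⟨hc.1, hW i.le_succ hc.2⟩)
    (fun i => by
      obtain ⟨c, hc, w, hw, rfl⟩ := Set.mem_iInter.1 hx i
      exact ⟨c, hc, by simpa using hw⟩)
    (closed_solutions 0).isCompact closed_solutions
  rw [Set.mem_iInter] at hc
  exact ⟨c, (hc 0).1, c⁻¹ * x, Subgroup.mem_iInf.2 fun i => (hc i).2, mul_inv_cancel_left c x⟩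

theorem sup_iInf_eq_top_of_isClosed {C : Subgroup K} (hC : IsClosed (C : Set K))
    {W : ℕ → Subgroup K} [∀ i, (W i).Normal] (hW : Antitone W)
    (hWclosed : ∀ i, IsClosed (W i : Set K)) (h : ∀ i, C ⊔ W i = ⊤) : C ⊔ ⨅ i, W i = ⊤ := by
  have : (⨅ i, W i).Normal := Subgroup.normal_iInf_normal inferInstance
  rw [← SetLike.coe_set_eq, Subgroup.mul_normal, mul_iInf_eq_iInter_mul hC hW hWclosed]
  simp only [← Subgroup.mul_normal, h, Subgroup.coe_top, Set.iInter_univ]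

theorem map_iInf_eq_iInf_map {Q : Type*} [Group Q] {f : K →* Q} (hf : IsClosed (f.ker : Set K))
    {W : ℕ → Subgroup K} (hW : Antitone W) (hWclosed : ∀ i, IsClosed (W i : Set K)) :
    (⨅ i, W i).map f = ⨅ i, (W i).map f := by
  refine (le_iInf fun i => Subgroup.map_mono (iInf_le W i)).antisymm fun q hq => ?_
  rw [Subgroup.mem_iInf] at hq
  obtain ⟨x, -, rfl⟩ := hq 0
  have hx : x ∈ ⋂ i, (f.ker : Set K) * (W i : Set K) := Set.mem_iInter.2 fun i => by
    rw [← Subgroup.normal_mul, sup_comm, ← Subgroup.comap_map_eq]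
    exact hq i
  rwa [← mul_iInf_eq_iInter_mul hf hW hWclosed, ← Subgroup.normal_mul, sup_comm,
    ← Subgroup.comap_map_eq] at hx

theorem exists_map_eq_map_iInf {Q : Type*} [Group Q] [Finite Q] {f : K →* Q}
    (hf : IsClosed (f.ker : Set K)) {W : ℕ → Subgroup K} (hW : Antitone W)
    (hWclosed : ∀ i, IsClosed (W i : Set K)) :
    ∃ n, ∀ j, n ≤ j → (W j).map f = (⨅ i, W i).map f := by
  rw [map_iInf_eq_iInf_map hf hW hWclosed]
  exact exists_forall_ge_eq_iInf_of_antitone fun i j hij => Subgroup.map_mono (hW hij)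

theorem isClosed_sup {A B : Subgroup K} [B.Normal] (hA : IsClosed (A : Set K))
    (hB : IsClosed (B : Set K)) : IsClosed ((A ⊔ B : Subgroup K) : Set K) := by
  rw [Subgroup.mul_normal]
  exact hB.mul_left_of_isCompact hA.isCompact

end CompactGroups

section VirtuallyAbelian

theorem isCompact_iSup_of_finite {A : Type*} [CommGroup A] [TopologicalSpace A]
    [IsTopologicalGroup A] {ι : Type*} [Finite ι] {B : ι → Subgroup A}
    (hB : ∀ i, IsCompact (B i : Set A)) : IsCompact ((⨆ i, B i : Subgroup A) : Set A) := by
  rw [← sSup_range]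
  refine Set.Finite.induction_on_subset _ (Set.finite_range B) ?_ ?_
  · simp
  · rintro _ s ⟨i, rfl⟩ - - hs
    rw [sSup_insert, Subgroup.mul_normal]
    exact (hB i).mul hs

variable {K : Type*} [Group K]

theorem commutator_top_eq_map_iSup_range_id_div (Z : Subgroup K) [Z.Normal] [IsMulCommutative Z] :
    ⁅Z, ⊤⁆ = (⨆ α : (MulAut.conjNormal : K →* MulAut Z).range,
      (MonoidHom.id Z / (α : MulAut Z).toMonoidHom).range).map Z.subtype := by
  refine le_antisymm (Subgroup.commutator_le.2 fun z hz g _ => ?_) ?_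
  · refine ⟨⟨z, hz⟩ / MulAut.conjNormal g ⟨z, hz⟩, ?_, ?_⟩
    · exact Subgroup.mem_iSup_of_mem ⟨MulAut.conjNormal g, g, rfl⟩ ⟨⟨z, hz⟩, rfl⟩
    · simp [commutatorElement_def, div_eq_mul_inv, mul_assoc]
  · rw [Subgroup.map_iSup, iSup_le_iff]
    rintro ⟨_, g, rfl⟩ _ ⟨_, ⟨z, rfl⟩, rfl⟩
    convert Subgroup.commutator_mem_commutator z.2 (Subgroup.mem_top g) using 1
    simp [commutatorElement_def, div_eq_mul_inv, mul_assoc]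

theorem finite_range_conjNormal (Z : Subgroup K) [Z.Normal] [IsMulCommutative Z]
    [Z.FiniteIndex] : Finite (MulAut.conjNormal : K →* MulAut Z).range := by
  have hker : Z ≤ (MulAut.conjNormal : K →* MulAut Z).ker := fun z hz =>
    MulEquiv.ext fun w => Subtype.ext <| by
      rw [MulAut.conjNormal_apply, mul_inv_eq_iff_eq_mul]
      exact congrArg Subtype.val (mul_comm (⟨z, hz⟩ : Z) w)
  have := Subgroup.finiteIndex_of_le hker
  exact Finite.of_equiv _ (QuotientGroup.quotientKerEquivRange MulAut.conjNormal).toEquiv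

variable [TopologicalSpace K] [IsTopologicalGroup K] [CompactSpace K] [T2Space K]

theorem isClosed_commutator_top {Z : Subgroup K} [Z.Normal] [IsMulCommutative Z] [Z.FiniteIndex]
    (hZ : IsClosed (Z : Set K)) : IsClosed ((⁅Z, ⊤⁆ : Subgroup K) : Set K) := by
  have := finite_range_conjNormal Z
  have : CompactSpace Z := isCompact_iff_compactSpace.1 hZ.isCompact
  rw [commutator_top_eq_map_iSup_range_id_div]
  refine ((isCompact_iSup_of_finite ?_).image continuous_subtype_val).isClosed
  rintro ⟨_, g, rfl⟩
  refine isCompact_range (f := fun z : Z => z / MulAut.conjNormal g z) ?_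
  refine continuous_id.div' (Continuous.subtype_mk ?_ _)
  fun_prop

theorem isClosed_commutator_of_finiteIndex {Z : Subgroup K} [Z.Normal] [IsMulCommutative Z]
    [Z.FiniteIndex] (hZ : IsClosed (Z : Set K)) : IsClosed (commutator K : Set K) := by
  let N : Subgroup K := ⁅Z, ⊤⁆
  let π := QuotientGroup.mk' N
  have π_surjective : Function.Surjective π := QuotientGroup.mk'_surjective N
  have hcentral : Z.map π ≤ Subgroup.center (K ⧸ N) := by
    rw [← Subgroup.commutator_top_right_eq_bot_iff_le_center,
      ← Subgroup.map_top_of_surjective π π_surjective, ← Subgroup.map_commutator,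
      Subgroup.map_eq_bot_iff, QuotientGroup.ker_mk']
  have : (Z.map π).FiniteIndex :=
    ⟨ne_zero_of_dvd_ne_zero Subgroup.FiniteIndex.index_ne_zero
      (Z.index_map_dvd π_surjective)⟩
  have := Subgroup.finiteIndex_of_le hcentral
  have := finite_commutator_of_finiteIndex_center (K := K ⧸ N)
  have : IsClosed (N : Set K) := isClosed_commutator_top hZ
  have hcomap : (commutator (K ⧸ N)).comap π = commutator K := by
    rw [commutator_def, ← Subgroup.map_top_of_surjective π π_surjective,
      ← Subgroup.map_commutator, Subgroup.comap_map_eq, QuotientGroup.ker_mk']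
    exact sup_eq_left.2 (Subgroup.commutator_mono le_top le_rfl)
  rw [← hcomap]
  exact (Set.toFinite (commutator (K ⧸ N) : Set (K ⧸ N))).isClosed.preimage
    (QuotientGroup.continuous_mk : Continuous π)

end VirtuallyAbelian

section CentralFiltrations

variable {K : Type*} [Group K] {U : ℕ → Subgroup K} [∀ i, (U i).Normal]

theorem commutator_iInf_lowerCentralSeries_sup_eq_bot (hU : Antitone U)
    (hcentral : ∀ i, ⁅U i, ⊤⁆ ≤ U (i + 1)) (hbot : ⨅ i, U i = ⊥) :
    ⁅⨅ i, (⊤ : Subgroup K).lowerCentralSeries i ⊔ U i, U 0⁆ = ⊥ := by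
  rw [eq_bot_iff, ← hbot]
  refine le_iInf fun i => (Subgroup.commutator_mono (iInf_le _ i) le_rfl).trans ?_
  refine commutator_sup_left_le ?_ ?_
  · calc
      ⁅(⊤ : Subgroup K).lowerCentralSeries i, U 0⁆ ≤ U (0 + i + 1) :=
        commutator_lowerCentralSeries_le hcentral i 0
      _ ≤ U i := hU (by lia)
  · exact Subgroup.commutator_le_left (U i) (U 0)

variable [TopologicalSpace K] [IsTopologicalGroup K] [CompactSpace K]

theorem sup_iInf_lowerCentralSeries_sup_eq_top {H : Subgroup K} (hH : IsClosed (H : Set K))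
    (hU : Antitone U) (hopen : ∀ i, IsOpen (U i : Set K))
    (hdense : ∀ i, H ⊔ commutator K ⊔ U i = ⊤) :
    H ⊔ ⨅ i, (⊤ : Subgroup K).lowerCentralSeries i ⊔ U i = ⊤ := by
  refine sup_iInf_eq_top_of_isClosed hH (fun i j hij => ?_) (fun i => ?_) fun i => ?_
  · exact sup_le_sup (Subgroup.lowerCentralSeries_antitone _ hij) (hU hij)
  · exact Subgroup.isClosed_of_isOpen _ (Subgroup.isOpen_mono le_sup_right (hopen i))
  · have hsup : H ⊔ U i ⊔ commutator K = ⊤ := by rw [sup_right_comm, hdense i]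
    rw [sup_comm _ (U i), ← sup_assoc, sup_lowerCentralSeries_eq_top hsup]

variable [T2Space K]

theorem sup_commutator_eq_top_of_forall_sup_eq_top {H : Subgroup K} [Finite H] (hU : Antitone U)
    (hopen : ∀ i, IsOpen (U i : Set K)) (hcentral : ∀ i, ⁅U i, ⊤⁆ ≤ U (i + 1))
    (hbot : ⨅ i, U i = ⊥) (hdense : ∀ i, H ⊔ commutator K ⊔ U i = ⊤) :
    H ⊔ commutator K = ⊤ := by
  have hH : IsClosed (H : Set K) := (Set.toFinite _).isClosed
  let P : Subgroup K := ⨅ i, (⊤ : Subgroup K).lowerCentralSeries i ⊔ U i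
  have hPclosed : IsClosed (P : Set K) := by
    rw [Subgroup.coe_iInf]
    exact isClosed_iInter fun i =>
      Subgroup.isClosed_of_isOpen _ (Subgroup.isOpen_mono le_sup_right (hopen i))
  have hPtop : H ⊔ P = ⊤ := sup_iInf_lowerCentralSeries_sup_eq_top hH hU hopen hdense
  have hPnormal : P.Normal := Subgroup.normal_iInf_normal inferInstance
  have hPU : ⁅P, U 0⁆ = ⊥ := commutator_iInf_lowerCentralSeries_sup_eq_bot hU hcentral hbot
  have : IsMulCommutative (P ⊓ U 0 : Subgroup K) := Subgroup.commutator_self_eq_bot_iff.1 <|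
    eq_bot_mono (Subgroup.commutator_mono inf_le_left inf_le_right) hPU
  have : P.FiniteIndex := finiteIndex_of_sup_eq_top hPtop
  have : Finite (K ⧸ U 0) := (U 0).quotient_finite_of_isOpen (hopen 0)
  have : (U 0).FiniteIndex := Subgroup.finiteIndex_of_finite_quotient
  have hcommutator : IsClosed (commutator K : Set K) :=
    isClosed_commutator_of_finiteIndex (Z := P ⊓ U 0)
      (hPclosed.inter (Subgroup.isClosed_of_isOpen _ (hopen 0)))
  simpa only [hbot, sup_bot_eq] using
    sup_iInf_eq_top_of_isClosed (isClosed_sup hH hcommutator) hU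
      (fun i => Subgroup.isClosed_of_isOpen _ (hopen i)) hdense

end CentralFiltrations

section InverseSequences

variable {X : ℕ → Type*} [∀ i, Group (X i)] (p : ∀ i, X (i + 1) →* X i)

/-- The sequences in `∏ X i` compatible with the maps `p i` for `i < j`. They approximate the
inverse limit `⨅ j, compatibleUpTo p j` from above, and unlike it surject onto `X j`. -/
def compatibleUpTo (j : ℕ) : Subgroup (∀ i, X i) :=
  ⨅ i, ⨅ _ : i < j, ((p i).comp (Pi.evalMonoidHom X (i + 1))).eqLocus (Pi.evalMonoidHom X i)

variable {p}

theorem mem_compatibleUpTo {j : ℕ} {x : ∀ i, X i} :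
    x ∈ compatibleUpTo p j ↔ ∀ i < j, p i (x (i + 1)) = x i := by
  simp only [compatibleUpTo, Subgroup.mem_iInf]
  rfl

theorem compatibleUpTo_antitone : Antitone (compatibleUpTo p) := fun _ _ hjk _ hx =>
  mem_compatibleUpTo.2 fun i hi => mem_compatibleUpTo.1 hx i (hi.trans_le hjk)

theorem mem_iInf_compatibleUpTo {x : ∀ i, X i} :
    x ∈ ⨅ j, compatibleUpTo p j ↔ ∀ i, p i (x (i + 1)) = x i := by
  simp only [Subgroup.mem_iInf, mem_compatibleUpTo]
  exact ⟨fun h i => h (i + 1) i i.lt_succ_self, fun h j i _ => h i⟩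

theorem eq_of_mem_compatibleUpTo {i j : ℕ} (hij : i ≤ j) {x y : ∀ i, X i}
    (hx : x ∈ compatibleUpTo p j) (hy : y ∈ compatibleUpTo p j) (hxy : x j = y j) : x i = y i := by
  induction hij using Nat.decreasingInduction with
  | self => exact hxy
  | of_succ k hk ih =>
    rw [← mem_compatibleUpTo.1 hx k hk, ← mem_compatibleUpTo.1 hy k hk, ih]

theorem map_eval_compatibleUpTo (j : ℕ) :
    (compatibleUpTo p j).map (Pi.evalMonoidHom X j) = ⊤ := by
  refine eq_top_iff.2 fun a _ => ?_
  induction j with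
  | zero =>
    exact ⟨Pi.mulSingle 0 a, mem_compatibleUpTo.2 fun i hi => absurd hi i.not_lt_zero,
      Pi.mulSingle_eq_same 0 a⟩
  | succ j ih =>
    obtain ⟨x, hx, hxj⟩ := ih (p j a) (Subgroup.mem_top _)
    refine ⟨Function.update x (j + 1) a, mem_compatibleUpTo.2 fun i hi => ?_,
      Function.update_self _ _ _⟩
    rw [Function.update_of_ne hi.ne]
    rcases (Nat.lt_succ_iff.1 hi).eq_or_lt with rfl | hij
    · rw [Function.update_self]
      exact hxj.symm
    · rw [Function.update_of_ne (by lia), mem_compatibleUpTo.1 hx i hij]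

theorem isClosed_compatibleUpTo [∀ i, TopologicalSpace (X i)] [∀ i, DiscreteTopology (X i)]
    (j : ℕ) : IsClosed (compatibleUpTo p j : Set (∀ i, X i)) := by
  simp only [compatibleUpTo, Subgroup.coe_iInf]
  exact isClosed_biInter fun i _ => isClosed_eq
    ((continuous_of_discreteTopology (f := p i)).comp (continuous_apply (i + 1)))
    (continuous_apply i)

theorem exists_map_eval_compatibleUpTo_eq [∀ i, Finite (X i)] (i : ℕ) :
    ∃ n, ∀ j, n ≤ j → (compatibleUpTo p j).map (Pi.evalMonoidHom X i) =
      (⨅ j, compatibleUpTo p j).map (Pi.evalMonoidHom X i) := by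
  let _ (i : ℕ) : TopologicalSpace (X i) := ⊥
  have (i : ℕ) : DiscreteTopology (X i) := ⟨rfl⟩
  have hker : IsClosed ((Pi.evalMonoidHom X i).ker : Set (∀ i, X i)) :=
    (isClosed_discrete {1}).preimage (continuous_apply i)
  exact exists_map_eq_map_iInf hker compatibleUpTo_antitone isClosed_compatibleUpTo

theorem map_eval_iInf_compatibleUpTo_le [∀ i, Finite (X i)] {A L : Subgroup (∀ i, X i)}
    (hL : L = ⨅ j, compatibleUpTo p j) (hA : A ≤ L)
    (hrange : ∀ j, (p j).range ≤ A.map (Pi.evalMonoidHom X j) ⊔ commutator (X j)) (i : ℕ) :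
    L.map (Pi.evalMonoidHom X i) ≤ (A ⊔ ⁅L, L⁆).map (Pi.evalMonoidHom X i) := by
  obtain ⟨n, hn⟩ := exists_map_eval_compatibleUpTo_eq (p := p) i
  let j := max n i
  let C := compatibleUpTo p j
  have hLC : L ≤ C := hL.trans_le (iInf_le _ j)
  have hCi : C.map (Pi.evalMonoidHom X i) = L.map (Pi.evalMonoidHom X i) := by
    rw [hL, hn j (le_max_left n i)]
  have hACC : A ⊔ ⁅C, C⁆ ≤ C := sup_le (hA.trans hLC) (Subgroup.commutator_le_self C)
  have hmap : (A ⊔ ⁅C, C⁆).map (Pi.evalMonoidHom X i) =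
      (A ⊔ ⁅L, L⁆).map (Pi.evalMonoidHom X i) := by
    simp only [Subgroup.map_sup, Subgroup.map_commutator, hCi]
  rw [← hmap]
  rintro _ ⟨x, hx, rfl⟩
  have hxj : x j ∈ (A ⊔ ⁅C, C⁆).map (Pi.evalMonoidHom X j) := by
    rw [Subgroup.map_sup, Subgroup.map_commutator, map_eval_compatibleUpTo, ← commutator_def]
    exact hrange j ⟨x (j + 1), mem_iInf_compatibleUpTo.1 (hL ▸ hx) j⟩
  obtain ⟨y, hy, hyx⟩ := hxj
  exact ⟨y, hy, eq_of_mem_compatibleUpTo (le_max_right n i) (hACC hy) (hLC hx) hyx⟩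

end InverseSequences

namespace NormalStructure

section

variable {M : Type u} {G : Type v} [Group M] [Group G] {n : M →* G}

theorem ker_le_center (S : NormalStructure n) : n.ker ≤ Subgroup.center M := fun m hm =>
  Subgroup.mem_center_iff.2 fun m' => by
    have h := S.peiffer m m'
    rw [MonoidHom.mem_ker.1 hm, map_one, MulAut.one_apply] at h
    exact eq_mul_inv_iff_mul_eq.1 h

/-- A surjective homomorphism with central kernel is a normal map: its target acts through
conjugation by preimages. -/
noncomputable def ofSurjective (hn : Function.Surjective n) (hker : n.ker ≤ Subgroup.center M) :
    NormalStructure n :=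
  have hconj : n.ker ≤ (MulAut.conj : M →* MulAut M).ker := fun m hm => MulEquiv.ext fun m' => by
    rw [MulAut.conj_apply, ← Subgroup.mem_center_iff.1 (hker hm) m', mul_inv_cancel_right,
      MulAut.one_apply]
  have act_apply (m : M) : n.liftOfSurjective hn ⟨MulAut.conj, hconj⟩ (n m) = MulAut.conj m :=
    n.liftOfRightInverse_comp_apply _ _ ⟨MulAut.conj, hconj⟩ m
  { act := n.liftOfSurjective hn ⟨MulAut.conj, hconj⟩
    equivariant := fun g m => by
      obtain ⟨m₀, rfl⟩ := hn g
      rw [act_apply, MulAut.conj_apply, map_mul, map_mul, map_inv]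
    peiffer := fun m m' => by rw [act_apply, MulAut.conj_apply] }

end

section

variable {M : Type u} {Q : Type v} {G : Type w} [Group M] [Group Q] [Group G]

/-- The fibre product `M ×_Q G` of `n : M → Q` and `a : G → Q`. -/
abbrev fiberProduct (n : M →* Q) (a : G →* Q) : Subgroup (M × G) :=
  (n.comp (MonoidHom.fst M G)).eqLocus (a.comp (MonoidHom.snd M G))

/-- Normal maps are stable under base change: the projection `M ×_Q G → G` is a normal map
whenever `n : M → Q` is one. -/
def pullback {n : M →* Q} (S : NormalStructure n) (a : G →* Q) :
    NormalStructure ((MonoidHom.snd M G).comp (fiberProduct n a).subtype) where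
  act := @MulDistribMulAction.toMulAut G _ _ _
    { smul := fun g x => ⟨(S.act (a g) x.1.1, g * x.1.2 * g⁻¹), by
        have hx : n x.1.1 = a x.1.2 := x.2
        change n (S.act (a g) x.1.1) = a (g * x.1.2 * g⁻¹)
        rw [S.equivariant, hx, map_mul, map_mul, map_inv]⟩
      one_smul := fun x => Subtype.ext <| Prod.ext
        (show S.act (a 1) x.1.1 = x.1.1 by simp) (show 1 * x.1.2 * 1⁻¹ = x.1.2 by simp)
      mul_smul := fun g h x => Subtype.ext <| Prod.ext
        (show S.act (a (g * h)) x.1.1 = S.act (a g) (S.act (a h) x.1.1) by simp)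
        (show g * h * x.1.2 * (g * h)⁻¹ = g * (h * x.1.2 * h⁻¹) * g⁻¹ by group)
      smul_mul := fun g x y => Subtype.ext <| Prod.ext (map_mul (S.act (a g)) x.1.1 y.1.1)
        conj_mul.symm
      smul_one := fun g => Subtype.ext <| Prod.ext (map_one (S.act (a g)))
        (show g * 1 * g⁻¹ = 1 by simp) }
  equivariant := fun _ _ => rfl
  peiffer := fun x y => Subtype.ext <| Prod.ext
    ((congrArg (fun q => S.act q y.1.1) (show a x.1.2 = n x.1.1 from x.2.symm)).trans
      (S.peiffer x.1.1 y.1.1)) rfl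

end

end NormalStructure

namespace FreeNormalClosure

variable {Γ : Type u} {G : Type v} [Group Γ] [Group G] (φ : Γ →* G)

theorem exists_lift {M Q : Type*} [Group M] [Group Q] {n : M →* Q} (S : NormalStructure n)
    (a : G →* Q) {ψ : Γ →* M} (h : n.comp ψ = a.comp φ) :
    ∃ f : FreeNormalClosure φ →* M, f.comp (ofDomain φ) = ψ ∧ n.comp f = a.comp (toCodomain φ) := by
  let ψ' : Γ →* NormalStructure.fiberProduct n a :=
    (ψ.prod φ).codRestrict _ (DFunLike.congr_fun h)
  obtain ⟨f, ⟨hfψ, hfn, -⟩, -⟩ := existsUnique_lift φ ψ' _ (S.pullback a) rfl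
  refine ⟨((MonoidHom.fst M G).comp (Subgroup.subtype _)).comp f, ?_, ?_⟩
  · rw [MonoidHom.comp_assoc, hfψ]
    rfl
  · rw [← hfn]
    exact MonoidHom.ext fun x => (f x).2

/-- The image `Γ → Γ^φ` of the copy of `Γ` indexed by `g`. -/
def ofCopy (g : G) : Γ →* FreeNormalClosure φ :=
  (QuotientGroup.mk' (peifferSubgroup φ)).comp (copy Γ g)

theorem toCodomain_ofCopy (g : G) (x : Γ) : toCodomain φ (ofCopy φ g x) = g * φ x * g⁻¹ :=
  copiesMap_copy φ g x

theorem iSup_range_ofCopy : ⨆ g, (ofCopy φ g).range = ⊤ := by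
  have hlift : Monoid.CoprodI.lift (ofCopy φ) = QuotientGroup.mk' (peifferSubgroup φ) :=
    copies_hom_ext fun g => Monoid.CoprodI.lift_of (ofCopy φ) (i := g)
  rw [← Monoid.CoprodI.range_eq_iSup, MonoidHom.range_eq_top, hlift]
  exact QuotientGroup.mk'_surjective _

theorem range_toCodomain_le {N : Subgroup G} [N.Normal] (hN : φ.range ≤ N) :
    (toCodomain φ).range ≤ N := by
  rw [MonoidHom.range_eq_map, ← iSup_range_ofCopy, Subgroup.map_iSup]
  refine iSup_le fun g => ?_
  rintro _ ⟨_, ⟨x, rfl⟩, rfl⟩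
  rw [toCodomain_ofCopy]
  exact Subgroup.Normal.conj_mem inferInstance _ (hN ⟨x, rfl⟩) g

theorem range_toCodomain_le_sup_commutator : (toCodomain φ).range ≤ φ.range ⊔ commutator G :=
  have : (φ.range ⊔ commutator G).Normal := Subgroup.Normal.of_commutator_le G le_sup_right
  range_toCodomain_le φ le_sup_left

theorem finite [Finite Γ] [Finite G] : Finite (FreeNormalClosure φ) := by
  have : (toCodomain φ).ker.FiniteIndex := inferInstance
  have := Subgroup.finiteIndex_of_le (normalStructure φ).ker_le_center
  refine finite_of_finiteIndex_center_of_closure_eq_top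
    (S := ⋃ g, Set.range (ofCopy φ g)) (Set.finite_iUnion fun g => Set.finite_range _) ?_ ?_
  · rintro _ ⟨_, ⟨g, rfl⟩, x, rfl⟩
    exact (ofCopy φ g).isOfFinOrder (isOfFinOrder_of_finite x)
  · rw [Subgroup.closure_iUnion, ← iSup_range_ofCopy φ]
    exact iSup_congr fun g => (ofCopy φ g).range.closure_eq

end FreeNormalClosure

section Tower

variable {Γ G : Type u} [Group Γ] [Group G] (φ : Γ →* G)

/-- The projection of `Γ_∞` onto the terms of the tower. -/
def towerProj (i : ℕ) : GammaInfty φ →* (tower φ i).carrier :=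
  (Pi.evalMonoidHom _ i).comp (towerLimit φ).subtype

theorem towerMap_comp_towerProj (i : ℕ) :
    (towerMap φ i).comp (towerProj φ (i + 1)) = towerProj φ i :=
  MonoidHom.ext fun x => x.2 i

theorem ker_towerProj_antitone : Antitone fun i => (towerProj φ i).ker :=
  antitone_nat_of_succ_le fun i x hx => by
    rw [← towerMap_comp_towerProj, MonoidHom.mem_ker, MonoidHom.comp_apply,
      MonoidHom.mem_ker.1 hx, map_one]

theorem iInf_ker_towerProj : ⨅ i, (towerProj φ i).ker = ⊥ :=
  eq_bot_iff.2 fun _ hx => Subtype.ext <| funext fun i => Subgroup.mem_iInf.1 hx i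

theorem commutator_ker_towerProj_le (i : ℕ) :
    ⁅(towerProj φ i).ker, ⊤⁆ ≤ (towerProj φ (i + 1)).ker := by
  have hmap : (towerProj φ i).ker.map (towerProj φ (i + 1)) ≤ (towerMap φ i).ker := by
    rw [Subgroup.map_le_iff_le_comap, MonoidHom.comap_ker, towerMap_comp_towerProj]
  have hcenter := hmap.trans (FreeNormalClosure.normalStructure _).ker_le_center
  rw [← Subgroup.map_eq_bot_iff, Subgroup.map_commutator, eq_bot_iff]
  exact (Subgroup.commutator_mono le_rfl le_top).trans
    (Subgroup.commutator_top_right_eq_bot_iff_le_center.2 hcenter).le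

theorem finite_tower [Finite Γ] [Finite G] (i : ℕ) : Finite (tower φ i).carrier := by
  induction i with
  | zero => assumption
  | succ i ih => exact FreeNormalClosure.finite (tower φ i).hom

theorem towerLimit_eq_iInf_compatibleUpTo :
    towerLimit φ = ⨅ j, compatibleUpTo (towerMap φ) j :=
  Subgroup.ext fun _ => (mem_iInf_compatibleUpTo (X := fun i => (tower φ i).carrier)).symm

theorem range_homInfty_sup_commutator_sup_ker_eq_top [Finite Γ] [Finite G] (i : ℕ) :
    (homInfty φ).range ⊔ commutator (GammaInfty φ) ⊔ (towerProj φ i).ker = ⊤ := by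
  have := finite_tower φ
  have hlimit := map_eval_iInf_compatibleUpTo_le (towerLimit_eq_iInf_compatibleUpTo φ)
    (A := (homInfty φ).range.map (towerLimit φ).subtype) (Subgroup.map_subtype_le _)
    (fun j => by
      rw [Subgroup.map_map, MonoidHom.map_range]
      exact FreeNormalClosure.range_toCodomain_le_sup_commutator (tower φ j).hom) i
  rw [← Subgroup.map_subtype_commutator, ← Subgroup.map_sup, Subgroup.map_map] at hlimit
  rw [← Subgroup.comap_map_eq, eq_top_iff]
  exact fun x _ => hlimit ⟨x, x.2, rfl⟩

theorem range_homInfty_sup_commutator_eq_top [Finite Γ] [Finite G] :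
    (homInfty φ).range ⊔ commutator (GammaInfty φ) = ⊤ := by
  have := finite_tower φ
  let _ (i : ℕ) : TopologicalSpace (tower φ i).carrier := ⊥
  have (i : ℕ) : DiscreteTopology (tower φ i).carrier := ⟨rfl⟩
  have hclosed : IsClosed (towerLimit φ : Set (∀ i, (tower φ i).carrier)) := by
    rw [towerLimit_eq_iInf_compatibleUpTo, Subgroup.coe_iInf]
    exact isClosed_iInter isClosed_compatibleUpTo
  have : CompactSpace (GammaInfty φ) := isCompact_iff_compactSpace.1 hclosed.isCompact
  have hopen (i : ℕ) : IsOpen ((towerProj φ i).ker : Set (GammaInfty φ)) :=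
    (isOpen_discrete {1}).preimage ((continuous_apply i).comp continuous_subtype_val)
  have : Finite (homInfty φ).range := Set.finite_range (homInfty φ)
  exact sup_commutator_eq_top_of_forall_sup_eq_top (ker_towerProj_antitone φ) hopen
    (commutator_ker_towerProj_le φ) (iInf_ker_towerProj φ)
    (range_homInfty_sup_commutator_sup_ker_eq_top φ)

end Tower

section LowerCentralSeriesOfTheLimit

variable {Γ : Type u} [Group Γ]

/-- The quotient map `Γ ⧸ N → Γ ⧸ N'` with `[N', Γ] ≤ N ≤ N'` is a normal map. -/
noncomputable def NormalStructure.quotientMapOfCommutatorLe {N N' : Subgroup Γ}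
    [N.Normal] [N'.Normal] (h : N ≤ N') (hcommutator : ⁅N', ⊤⁆ ≤ N) :
    NormalStructure (QuotientGroup.map N N' (MonoidHom.id Γ) (h.trans_eq N'.comap_id.symm)) :=
  .ofSurjective (QuotientGroup.map_surjective_of_surjective _ _ _ QuotientGroup.mk_surjective _) (by
      rw [QuotientGroup.ker_map, Subgroup.comap_id,
        ← Subgroup.commutator_top_right_eq_bot_iff_le_center,
        ← Subgroup.map_top_of_surjective _ (QuotientGroup.mk'_surjective N),
        ← Subgroup.map_commutator, Subgroup.map_eq_bot_iff, QuotientGroup.ker_mk']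
      exact hcommutator)

variable {G : Type u} [Group G] (φ : Γ →* G)

theorem exists_tower_lift_quotient_lowerCentralSeries (i : ℕ) :
    ∃ f : (tower φ i).carrier →* Γ ⧸ (⊤ : Subgroup Γ).lowerCentralSeries i,
      f.comp (tower φ i).hom = QuotientGroup.mk' _ := by
  induction i with
  | zero =>
    exact ⟨1, MonoidHom.ext fun x =>
      ((QuotientGroup.eq_one_iff x).2 (Subgroup.mem_top x)).symm⟩
  | succ i ih =>
    obtain ⟨a, ha⟩ := ih
    obtain ⟨f, hf, -⟩ := FreeNormalClosure.exists_lift (tower φ i).hom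
      (.quotientMapOfCommutatorLe (Subgroup.lowerCentralSeries_antitone _ i.le_succ) le_rfl) a
      (ψ := QuotientGroup.mk' _) ha.symm
    exact ⟨f, hf⟩

theorem comap_homInfty_lowerCentralSeries_le (i : ℕ) :
    ((⊤ : Subgroup (GammaInfty φ)).lowerCentralSeries i).comap (homInfty φ) ≤
      (⊤ : Subgroup Γ).lowerCentralSeries i := fun x hx => by
  obtain ⟨f, hf⟩ := exists_tower_lift_quotient_lowerCentralSeries φ i
  let N := (⊤ : Subgroup Γ).lowerCentralSeries i
  have hbot : (⊤ : Subgroup (Γ ⧸ N)).lowerCentralSeries i = ⊥ := by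
    rw [← Subgroup.map_top_of_surjective _ (QuotientGroup.mk'_surjective N),
      ← Subgroup.map_lowerCentralSeries, Subgroup.map_eq_bot_iff, QuotientGroup.ker_mk']
  have hfx : f.comp (towerProj φ i) (homInfty φ x) = QuotientGroup.mk' N x :=
    DFunLike.congr_fun hf x
  have hmem : f.comp (towerProj φ i) (homInfty φ x) ∈
      (⊤ : Subgroup (Γ ⧸ N)).lowerCentralSeries i :=
    gammaSeries_le_comap (f.comp (towerProj φ i)) (i + 1) hx
  rw [hbot, hfx] at hmem
  exact (QuotientGroup.eq_one_iff x).1 hmem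

theorem comap_homInfty_gammaSeries (k : ℕ) :
    (gammaSeries (GammaInfty φ) k).comap (homInfty φ) = gammaSeries Γ k :=
  (comap_homInfty_lowerCentralSeries_le φ (k - 1)).antisymm (gammaSeries_le_comap _ k)

end LowerCentralSeriesOfTheLimit

section GammaQuotients

variable {A B : Type*} [Group A] [Group B] {f : A →* B}

theorem quotientMap_injective {M : Subgroup A} {N : Subgroup B} [M.Normal] [N.Normal]
    (h : N.comap f = M) : Function.Injective (QuotientGroup.map M N f h.ge) := by
  rw [← MonoidHom.ker_eq_bot_iff, QuotientGroup.ker_map, h, Subgroup.map_eq_bot_iff,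
    QuotientGroup.ker_mk']

theorem quotientMap_surjective {M : Subgroup A} {N : Subgroup B} [M.Normal] [N.Normal]
    (hMN : M ≤ N.comap f) (h : f.range ⊔ N = ⊤) :
    Function.Surjective (QuotientGroup.map M N f hMN) := fun q => by
  obtain ⟨b, rfl⟩ := QuotientGroup.mk_surjective q
  obtain ⟨_, ⟨a, rfl⟩, n, hn, rfl⟩ := Subgroup.mem_sup_of_normal_right.1 (h.ge (Subgroup.mem_top b))
  exact ⟨a, (QuotientGroup.mk_mul_of_mem (f a) hn).symm⟩

theorem le_of_comap_le_comap_of_range_sup_eq_top {M N : Subgroup B} [N.Normal] (hNM : N ≤ M)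
    (hcomap : M.comap f ≤ N.comap f) (hsup : f.range ⊔ N = ⊤) : M ≤ N := fun b hb => by
  obtain ⟨_, ⟨a, rfl⟩, n, hn, rfl⟩ :=
    Subgroup.mem_sup_of_normal_right.1 (hsup.ge (Subgroup.mem_top b))
  exact mul_mem (hcomap ((Subgroup.mul_mem_cancel_right M (hNM hn)).1 hb)) hn

theorem gammaSeries_antitone : Antitone (gammaSeries A) := fun _ _ hkl =>
  Subgroup.lowerCentralSeries_antitone _ (Nat.sub_le_sub_right hkl 1)

theorem gammaTerminatesAt_gammaResidual_of_finite [Finite A] :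
    GammaTerminatesAt A (gammaResidual A) := by
  obtain ⟨n, hn⟩ := exists_forall_ge_eq_iInf_of_antitone (gammaSeries_antitone (A := A))
  exact ⟨n + 1, n.succ_pos, fun s hs => hn s (n.le_succ.trans hs)⟩

theorem comap_gammaResidual (hcomap : ∀ k, (gammaSeries B k).comap f = gammaSeries A k) :
    (gammaResidual B).comap f = gammaResidual A := by
  simp only [gammaResidual, Subgroup.comap_iInf, hcomap]

theorem GammaTerminatesAt.sup_gammaResidual_eq_top {H T : Subgroup A} (h : GammaTerminatesAt A T)
    (hsup : ∀ k, H ⊔ gammaSeries A k = ⊤) : H ⊔ gammaResidual A = ⊤ := by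
  rw [h.eq_gammaResidual]
  obtain ⟨t, -, ht⟩ := h
  rw [← ht t le_rfl, hsup]

theorem GammaTerminatesAt.gammaResidual_of_comap {T : Subgroup A} (h : GammaTerminatesAt A T)
    (hcomap : ∀ k, (gammaSeries B k).comap f = gammaSeries A k)
    (hsup : ∀ k, f.range ⊔ gammaSeries B k = ⊤) : GammaTerminatesAt B (gammaResidual B) := by
  obtain ⟨t, ht_pos, ht⟩ := h
  have hB : GammaTerminatesAt B (gammaSeries B t) := by
    refine ⟨t, ht_pos, fun s hs => (gammaSeries_antitone hs).antisymm ?_⟩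
    refine le_of_comap_le_comap_of_range_sup_eq_top (gammaSeries_antitone hs) ?_ (hsup s)
    rw [hcomap, hcomap, ht t le_rfl, ht s hs]
  exact hB.eq_gammaResidual.symm ▸ hB

end GammaQuotients

end SubnormalClosure

theorem mainTheorem5 {Γ G : Type u} [Group Γ] [Group G] (φ : Γ →* G) :
    (∀ k : ℕ, 1 ≤ k →
      Function.Injective
        (SubnormalClosure.gammaQuotientMap (SubnormalClosure.homInfty φ) k)) ∧
    (Finite Γ → Finite G →
      (∀ k : ℕ, 1 ≤ k →
        Function.Bijective
          (SubnormalClosure.gammaQuotientMap (SubnormalClosure.homInfty φ) k)) ∧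
      SubnormalClosure.GammaTerminatesAt Γ (SubnormalClosure.gammaResidual Γ) ∧
      SubnormalClosure.GammaTerminatesAt (SubnormalClosure.GammaInfty φ)
        (SubnormalClosure.gammaResidual (SubnormalClosure.GammaInfty φ)) ∧
      Function.Bijective
        (SubnormalClosure.gammaResidualQuotientMap (SubnormalClosure.homInfty φ))) := by
  have hcomap := SubnormalClosure.comap_homInfty_gammaSeries φ
  have hinj (k : ℕ) := SubnormalClosure.quotientMap_injective (hcomap k)
  refine ⟨fun k _ => hinj k, fun _ _ => ?_⟩
  have hsup (k : ℕ) := SubnormalClosure.sup_lowerCentralSeries_eq_top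
    (SubnormalClosure.range_homInfty_sup_commutator_eq_top φ) (k - 1)
  have hΓ := SubnormalClosure.gammaTerminatesAt_gammaResidual_of_finite (A := Γ)
  have hlimit := hΓ.gammaResidual_of_comap hcomap hsup
  exact ⟨fun k _ => ⟨hinj k, SubnormalClosure.quotientMap_surjective (hcomap k).ge (hsup k)⟩,
    hΓ, hlimit,
    SubnormalClosure.quotientMap_injective (SubnormalClosure.comap_gammaResidual hcomap),
    SubnormalClosure.quotientMap_surjective (SubnormalClosure.comap_gammaResidual hcomap).ge
      (hlimit.sup_gammaResidual_eq_top hsup)⟩
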